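/- Let $G$ be a finite group, let $P$ be a set of prime numbers not dividing $2\cdot\#G$, and let $\mathbb{Z}_{(P)}\subset\mathbb{Q}$ be the ring of all fractions $a/b$ with $a,b\in\mathbb{Z}$, $b\neq 0$, and $b$ not divisible by any $p\in P$. Let $A$ be the quotient of $\mathbb{Q}[G]$ by a two-sided ideal containing $\sum_{g\in G}g$, let $\Lambda$ be the image of $\mathbb{Z}_{(P)}[G]$ in $A$, and let $V$ be a finitely generated $\mathbb{Q}[G]$-module. Let $K$ be a number field with algebraic closure $\bar K$. Let $\mathcal{F}$ be the set of all pairs $(F,i)$, where $F\subset\bar K$ is a Galois extension of $K$ that contains no primitive $p$-th root of unity for any $p\in P$, and $i$ is an isomorphism between $\mathrm{Gal}(F/K)$ and $G$ such that, when $\mathrm{Gal}(F/K)$-modules are viewed as $G$-modules via $i$, there is an isomorphism $\mathbb{Q}[G]\otimes_{\mathbb{Z}[G]}\mathcal{O}_F^\times\cong V$ of $\mathbb{Q}[G]$-modules. For a ring $T$ let $G_0(T)$ be the Grothendieck group of the category of finitely generated left $T$-modules. Let $(F,i)$ and $(F',i')\in\mathcal{F}$, and let $S_\infty$ and $S_\infty'$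 be the sets of Archimedean places of $F$ and $F'$, respectively, viewed as $G$-sets via $i$ and $i'$. Then the equality $$[\Lambda\otimes_{\mathbb{Z}[G]}\mathbb{Z}[S_\infty]]=[\Lambda\otimes_{\mathbb{Z}[G]}\mathbb{Z}[S_\infty']]$$ holds in $G_0(\Lambda)$. Moreover, the $G$-sets $S_\infty$ and $S_\infty'$ are isomorphic. -/

import Mathlib

open NumberField TensorProduct

universe u v w x

noncomputable section

namespace CohenLenstraMartinet

/-! ### The Grothendieck group of finitely generated modules -/

section GrothendieckGroup

/-- The relations `[M] = [L] + [N]`, one for every short exact sequence `0 → L → M → N → 0` of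
finitely generated left `R`-modules. -/
def shortExactRelations (R : Type u) [Ring R] :
    Set (FreeAbelianGroup (FGModuleCat.{max u v} R)) :=
  {r | ∃ (L M N : FGModuleCat.{max u v} R) (f : L →ₗ[R] M) (g : M →ₗ[R] N),
    Function.Injective f ∧ Function.Exact f g ∧ Function.Surjective g ∧
    r = FreeAbelianGroup.of M - (FreeAbelianGroup.of L + FreeAbelianGroup.of N)}

/-- The Grothendieck group `G₀(R)` of the category of finitely generated left `R`-modules.
Isomorphic modules have the same class, by the relations for `0 → 0 → M → M' → 0` and
`0 → 0 → 0 → 0 → 0`. The modules live in a universe at least that of `R`, so that every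
finitely generated `R`-module is, up to isomorphism, one of the generators. -/
def G0 (R : Type u) [Ring R] : Type (max (u + 1) (v + 1)) :=
  FreeAbelianGroup (FGModuleCat.{max u v} R) ⧸
    AddSubgroup.closure (shortExactRelations.{u, v} R)

instance (R : Type u) [Ring R] : AddCommGroup (G0.{u, v} R) :=
  inferInstanceAs (AddCommGroup (FreeAbelianGroup (FGModuleCat.{max u v} R) ⧸
    AddSubgroup.closure (shortExactRelations.{u, v} R)))

/-- The class `[M]` in `G₀(R)` of a finitely generated left `R`-module `M`. -/
def G0.cls (R : Type u) [Ring R] (M : Type (max u v)) [AddCommGroup M] [Module R M]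
    [Module.Finite R M] : G0.{u, v} R :=
  QuotientAddGroup.mk (FreeAbelianGroup.of (FGModuleCat.of R M))

end GrothendieckGroup

/-! ### Extension of scalars along a homomorphism of not necessarily commutative rings -/

section ExtendScalars

variable {R : Type u} {S : Type v} [Ring R] [Ring S]

/-- For a ring homomorphism `φ : R → S` and a left `R`-module `M`, the `S`-submodule of `S ⊗_ℤ M`
generated by all `s φ(r) ⊗ m - s ⊗ r m`. -/
def balancedRelations (φ : R →+* S) (M : Type w) [AddCommGroup M] [Module R M] :
    Submodule S (S ⊗[ℤ] M) :=
  Submodule.span S {t | ∃ (s : S) (r : R) (m : M),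
    t = (s * φ r) ⊗ₜ[ℤ] m - s ⊗ₜ[ℤ] (r • m)}

/-- The left `S`-module `S ⊗_R M`, where `S` is a right `R`-module through `φ : R → S`. -/
abbrev ExtendScalars (φ : R →+* S) (M : Type w) [AddCommGroup M] [Module R M] : Type (max v w) :=
  (S ⊗[ℤ] M) ⧸ balancedRelations φ M

instance (φ : R →+* S) (M : Type w) [AddCommGroup M] [Module R M] [Module.Finite ℤ M] :
    Module.Finite S (ExtendScalars φ M) :=
  Module.Finite.quotient S _

end ExtendScalars

/-! ### The coefficient rings -/

section Coefficients

/-- `ℤ_(P)`, the ring of all fractions `a / b` with `a, b` integers such that `b` is non-zero and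
not divisible by any prime in `P`. -/
def localInt (P : Set Nat.Primes) : Subring ℚ where
  carrier := {q | ∃ a b : ℤ, b ≠ 0 ∧ (∀ p ∈ P, ¬ ((p : ℕ) : ℤ) ∣ b) ∧ q = (a : ℚ) / (b : ℚ)}
  one_mem' := ⟨1, 1, one_ne_zero, fun p _ h =>
    p.2.one_lt.ne' (by exact_mod_cast Int.eq_one_of_dvd_one (by positivity) h), by simp⟩
  zero_mem' := ⟨0, 1, one_ne_zero, fun p _ h =>
    p.2.one_lt.ne' (by exact_mod_cast Int.eq_one_of_dvd_one (by positivity) h), by simp⟩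
  mul_mem' := by
    rintro _ _ ⟨a, b, hb, hP, rfl⟩ ⟨c, d, hd, hQ, rfl⟩
    refine ⟨a * c, b * d, mul_ne_zero hb hd, fun p hp h => ?_, by push_cast; field_simp⟩
    rcases (Nat.prime_iff_prime_int.mp p.2).dvd_or_dvd h with h | h
    · exact hP p hp h
    · exact hQ p hp h
  add_mem' := by
    rintro _ _ ⟨a, b, hb, hP, rfl⟩ ⟨c, d, hd, hQ, rfl⟩
    refine ⟨a * d + b * c, b * d, mul_ne_zero hb hd, fun p hp h => ?_, ?_⟩
    · rcases (Nat.prime_iff_prime_int.mp p.2).dvd_or_dvd h with h | h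
      · exact hP p hp h
      · exact hQ p hp h
    · have hb' : (b : ℚ) ≠ 0 := by exact_mod_cast hb
      have hd' : (d : ℚ) ≠ 0 := by exact_mod_cast hd
      push_cast
      field_simp
  neg_mem' := by
    rintro _ ⟨a, b, hb, hP, rfl⟩
    exact ⟨-a, b, hb, hP, by push_cast; ring⟩

variable {G : Type u} [Group G]

/-- The map `ℤ_(P)[G] → A`, where `A = ℚ[G] / I`. -/
def localToQuotient (P : Set Nat.Primes) (I : TwoSidedIdeal (MonoidAlgebra ℚ G)) :
    MonoidAlgebra (localInt P) G →+* I.ringCon.Quotient :=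
  I.ringCon.mk'.comp (MonoidAlgebra.mapRingHom G (localInt P).subtype)

/-- `Λ`, the image of `ℤ_(P)[G]` in `A = ℚ[G] / I`. -/
abbrev Lam (P : Set Nat.Primes) (I : TwoSidedIdeal (MonoidAlgebra ℚ G)) :
    Subring I.ringCon.Quotient :=
  (localToQuotient P I).range

/-- The canonical map `ℤ[G] → Λ`. -/
def intToLam (P : Set Nat.Primes) (I : TwoSidedIdeal (MonoidAlgebra ℚ G)) :
    MonoidAlgebra ℤ G →+* Lam P I :=
  (localToQuotient P I).rangeRestrict.comp
    (MonoidAlgebra.mapRingHom G (Int.castRingHom (localInt P)))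

/-- The inclusion `ℤ[G] → ℚ[G]`. -/
def intToRat (G : Type u) [Group G] : MonoidAlgebra ℤ G →+* MonoidAlgebra ℚ G :=
  MonoidAlgebra.mapRingHom G (Int.castRingHom ℚ)

end Coefficients

/-! ### Galois extensions with an identification of the Galois group -/

section Fields

/-- A pair `(F, i)`, where `F` is a Galois extension of `K` inside `Kbar`, and `i` is an
isomorphism between the Galois group of `F / K` and `G`. -/
structure GaloisPair (K : Type w) [Field K] (Kbar : Type v) [Field Kbar] [Algebra K Kbar]
    (G : Type u) [Group G] where
  field : IntermediateField K Kbar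
  isGalois : IsGalois K field
  iso : Gal(field/K) ≃* G

variable {K : Type w} [Field K] {Kbar : Type v} [Field Kbar] [Algebra K Kbar]
  {G : Type u} [Group G]

namespace GaloisPair

variable (X : GaloisPair K Kbar G)

/-- The set `S_∞` of Archimedean places of `F`. -/
def Places : Type v := InfinitePlace X.field

/-- `G` acts on `S_∞` through `i`; an element `σ` of the Galois group sends the place `|·|` to
`|σ⁻¹(·)|`. -/
instance : MulAction G X.Places :=
  MulAction.compHom (InfinitePlace X.field) X.iso.symm.toMonoidHom

/-- The action of `G` on `𝒪_F^×` through `i`, written additively. -/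
def unitsRep : Representation ℤ G (Additive (𝓞 X.field)ˣ) where
  toFun g := (MonoidHom.toAdditive
    (Units.map (RingOfIntegers.mapRingEquiv (X.iso.symm g).toRingEquiv :
      𝓞 X.field →* 𝓞 X.field))).toIntLinearMap
  map_one' := by
    ext y
    simp [RingOfIntegers.mapRingEquiv]
  map_mul' g h := by
    ext y
    simp [RingOfIntegers.mapRingEquiv]

/-- `𝒪_F^×` as a `ℤ[G]`-module. -/
abbrev UnitModule : Type v := X.unitsRep.asModule

/-- The permutation module `ℤ[S_∞]` as a `ℤ[G]`-module. -/
abbrev PlaceModule : Type v := (Representation.ofMulAction ℤ G X.Places).asModule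

theorem numberField [NumberField K] [Finite G] : NumberField X.field := by
  have := X.isGalois
  have : Finite Gal(X.field/K) := Finite.of_equiv G X.iso.symm.toEquiv
  have : FiniteDimensional K X.field := IsGalois.finiteDimensional_of_finite K X.field
  exact NumberField.of_module_finite K X.field

instance [NumberField K] [Finite G] : Finite X.Places := by
  have := X.numberField
  exact inferInstanceAs (Finite (InfinitePlace X.field))

instance [NumberField K] [Finite G] : Module.Finite ℤ X.PlaceModule := by
  have h : Module.Finite ℤ (MonoidAlgebra ℤ X.Places) := inferInstance
  have e : X.PlaceModule ≃+ MonoidAlgebra ℤ X.Places :=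
    (Representation.asModuleEquiv _).toAddEquiv
  exact Module.Finite.equiv e.symm.toIntLinearEquiv

end GaloisPair

/-- The family `ℱ` of all pairs `(F, i)` such that `F` contains no primitive `p`-th root of unity
for any `p ∈ P`, and such that `ℚ[G] ⊗_{ℤ[G]} 𝒪_F^×` is isomorphic to `V` over `ℚ[G]`. -/
def family (K : Type w) [Field K] (Kbar : Type v) [Field Kbar] [Algebra K Kbar]
    {G : Type u} [Group G] (P : Set Nat.Primes)
    (V : Type x) [AddCommGroup V] [Module (MonoidAlgebra ℚ G) V] : Set (GaloisPair K Kbar G) :=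
  {X | (∀ p ∈ P, ∀ ζ : X.field, ¬ IsPrimitiveRoot ζ (p : ℕ)) ∧
    Nonempty (ExtendScalars (intToRat G) X.UnitModule ≃ₗ[MonoidAlgebra ℚ G] V)}

end Fields

end CohenLenstraMartinet

end

open CohenLenstraMartinet

/-! ### Finite group actions with stabilizers of order at most two -/

section GSets

open MulAction

/-! The `ℚ[G]`-module `V` determines the `G`-set of Archimedean places. For each subgroup `H` of
`G`, the `H`-orbits on `S_∞` are the Archimedean places of the fixed field `F^H`. By Dirichlet's
unit theorem their number is one more than the rank of the units of `F^H`, which are the `H`-fixed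
units of `F` (`card_orbits_places`). Tensoring with `ℚ` preserves the rank of fixed points
(`finrank_groupFixed_extendScalars`), so this number is `1 + dim V^H`, the same for both fields.

Orbit counts do not determine a general finite `G`-set, but here stabilizers are decomposition
groups at Archimedean places, hence of order at most two. Then `H = 1` gives the number of points,
and Burnside's lemma for `⟨σ⟩` gives the number of fixed points of each involution `σ`; other
non-trivial elements fix nothing. This yields the number of points with each given stabilizer, so
the two `G`-sets are isomorphic (`exists_equivariant_equiv_of_card_orbits`). The equality in `G₀(Λ)`
follows, since the permutation modules, and so their extensions to `Λ`, are isomorphic. -/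

theorem exists_orbit_equiv_of_stabilizer_eq {G S S' : Type*} [Group G] [MulAction G S]
    [MulAction G S'] {s : S} {s' : S'} (h : stabilizer G s = stabilizer G s') :
    ∃ e : orbit G s ≃ orbit G s', ∀ (g : G) (t : orbit G s), (e (g • t) : S') = g • (e t : S') := by
  let e := (orbitEquivQuotientStabilizer G s).trans
    ((Subgroup.quotientEquivOfEq h).trans (orbitEquivQuotientStabilizer G s').symm)
  have he : ∀ (g : G) (t : orbit G s), (t : S) = g • s → (e t : S') = g • s' := by
    intro g t ht
    have : orbitEquivQuotientStabilizer G s t = (g : G ⧸ stabilizer G s) := by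
      rw [← Equiv.eq_symm_apply]
      exact Subtype.ext (by rw [ht, orbitEquivQuotientStabilizer_symm_apply])
    simp only [e, Equiv.trans_apply, this, Subgroup.quotientEquivOfEq_mk,
      orbitEquivQuotientStabilizer_symm_apply]
  refine ⟨e, fun g t => ?_⟩
  obtain ⟨k, hk⟩ := t.2
  rw [he k t hk.symm, he (g * k) (g • t), mul_smul]
  rw [orbit.coe_smul, ← hk, mul_smul]

theorem stabilizer_eq_of_injective {G S S' : Type*} [Group G] [MulAction G S] [MulAction G S']
    {f : S → S'} (hf : Function.Injective f) (hfe : ∀ (g : G) (s : S), f (g • s) = g • f s)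
    (s : S) : stabilizer G (f s) = stabilizer G s := by
  ext g
  rw [mem_stabilizer_iff, mem_stabilizer_iff, ← hfe, hf.eq_iff]

theorem smul_mem_orbit_iff {G S : Type*} [Group G] [MulAction G S] {g : G} {s t : S} :
    g • t ∈ orbit G s ↔ t ∈ orbit G s := by
  rw [← orbit_eq_iff, ← orbit_eq_iff, orbit_smul]

/-- The complement of an orbit. -/
def orbitCompl (G : Type*) {S : Type*} [Group G] [MulAction G S] (s : S) : SubMulAction G S where
  carrier := (orbit G s)ᶜ
  smul_mem' _ _ ht h := ht (smul_mem_orbit_iff.mp h)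

/-- Stabilizers do not change on passing to an invariant subset, so the count splits. This lets an
induction remove one orbit. -/
theorem ncard_stabilizer_eq_add {G S : Type*} [Group G] [MulAction G S] [Finite S] (s : S)
    (H : Subgroup G) :
    {t : S | stabilizer G t = H}.ncard = {t : orbit G s | stabilizer G t = H}.ncard +
      {t : orbitCompl G s | stabilizer G t = H}.ncard := by
  rw [← Set.ncard_inter_add_ncard_sdiff_eq_ncard _ (orbit G s)]
  congr 1
  · rw [← Set.ncard_image_of_injective {t : orbit G s | _} Subtype.val_injective]
    congr 1
    ext t
    constructor
    · rintro ⟨h, ht⟩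
      exact ⟨⟨t, ht⟩, (stabilizer_eq_of_injective Subtype.val_injective
        (fun _ _ => rfl) (⟨t, ht⟩ : orbit G s)).symm.trans h, rfl⟩
    · rintro ⟨t, h, rfl⟩
      exact ⟨(stabilizer_eq_of_injective Subtype.val_injective (fun _ _ => rfl) t).trans h, t.2⟩
  · rw [← Set.ncard_image_of_injective {t : orbitCompl G s | _} Subtype.val_injective]
    congr 1
    ext t
    constructor
    · rintro ⟨h, ht⟩
      exact ⟨⟨t, ht⟩, (stabilizer_eq_of_injective Subtype.val_injective
        (fun _ _ => rfl) (⟨t, ht⟩ : orbitCompl G s)).symm.trans h, rfl⟩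
    · rintro ⟨t, h, rfl⟩
      exact ⟨(stabilizer_eq_of_injective Subtype.val_injective (fun _ _ => rfl) t).trans h, t.2⟩

/-- Two finite `G`-sets that have, for every subgroup `H`, the same number of points with
stabilizer `H` are isomorphic. -/
theorem exists_equivariant_equiv_of_ncard_stabilizer {G : Type*} [Group G] (n : ℕ) :
    ∀ {S : Type v} {S' : Type w} [MulAction G S] [MulAction G S'] [Finite S] [Finite S'],
      Nat.card S = n →
      (∀ H : Subgroup G, {s : S | stabilizer G s = H}.ncard =
        {s : S' | stabilizer G s = H}.ncard) →
      ∃ e : S ≃ S', ∀ (g : G) (s : S), e (g • s) = g • e s := by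
  classical
  induction n using Nat.strong_induction_on with
  | _ n ih =>
  intro S S' _ _ _ _ hn h
  rcases isEmpty_or_nonempty S with hS | ⟨⟨s⟩⟩
  · have hS' : IsEmpty S' := by
      refine ⟨fun s' => ?_⟩
      have h1 := h (stabilizer G s')
      rw [Set.eq_empty_of_isEmpty {s : S | _}, Set.ncard_empty, eq_comm, Set.ncard_eq_zero] at h1
      exact Set.eq_empty_iff_forall_notMem.mp h1 s' rfl
    exact ⟨Equiv.equivOfIsEmpty S S', fun _ s => hS.elim s⟩
  -- Match the orbit of `s` with an orbit in `S'` having the same stabilizer, then apply induction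
  -- to the complements.
  · obtain ⟨s', hs'⟩ : ∃ s' : S', stabilizer G s' = stabilizer G s := by
      have h1 : 0 < {t : S | stabilizer G t = stabilizer G s}.ncard :=
        (Set.ncard_pos).mpr ⟨s, rfl⟩
      rw [h, Set.ncard_pos] at h1
      exact h1
    obtain ⟨e, he⟩ := exists_orbit_equiv_of_stabilizer_eq hs'.symm
    have he' : ∀ (g : G) (t : orbit G s), e (g • t) = g • e t := fun g t => Subtype.ext (he g t)
    obtain ⟨f, hf⟩ := ih (Nat.card (orbitCompl G s)) (by
        rw [← hn]
        exact Finite.card_subtype_lt (x := s) (fun h => h (mem_orbit_self s)))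
      (S := orbitCompl G s) (S' := orbitCompl G s') rfl (fun H => by
        have h1 := h H
        rw [ncard_stabilizer_eq_add s, ncard_stabilizer_eq_add s'] at h1
        have h2 : {t : orbit G s | stabilizer G t = H}.ncard =
            {t : orbit G s' | stabilizer G t = H}.ncard := by
          rw [← Set.ncard_image_of_injective _ e.injective]
          congr 1
          ext t
          constructor
          · rintro ⟨t, ht, rfl⟩
            exact (stabilizer_eq_of_injective e.injective he' t).trans ht
          · intro ht
            refine ⟨e.symm t, ?_, by simp⟩
            rw [Set.mem_ofPred_eq, ← stabilizer_eq_of_injective e.injective he',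
              Equiv.apply_symm_apply]
            exact ht
        omega)
    -- The same map, retyped between set complements so that `Equiv.Set.sumCompl` can glue it to
    -- `e`.
    let f' : ↑(orbit G s)ᶜ ≃ ↑(orbit G s')ᶜ := f
    refine ⟨(Equiv.Set.sumCompl (orbit G s)).symm.trans
      ((Equiv.sumCongr e f').trans (Equiv.Set.sumCompl (orbit G s'))), fun g t => ?_⟩
    by_cases ht : t ∈ orbit G s
    · have hg : g • t ∈ orbit G s := smul_mem_orbit_iff.mpr ht
      simp only [Equiv.trans_apply, Equiv.Set.sumCompl_symm_apply_of_mem ht,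
        Equiv.Set.sumCompl_symm_apply_of_mem hg, Equiv.sumCongr_apply, Sum.map_inl,
        Equiv.Set.sumCompl_apply_inl]
      exact he g ⟨t, ht⟩
    · have hg : g • t ∉ orbit G s := fun h => ht (smul_mem_orbit_iff.mp h)
      simp only [Equiv.trans_apply, Equiv.Set.sumCompl_symm_apply_of_notMem ht,
        Equiv.Set.sumCompl_symm_apply_of_notMem hg, Equiv.sumCongr_apply, Sum.map_inr,
        Equiv.Set.sumCompl_apply_inr]
      exact congrArg Subtype.val (hf g ⟨t, ht⟩)

/-- Burnside's lemma for the group generated by an element of order two. -/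
theorem card_add_ncard_fixedBy {G S : Type*} [Group G] [MulAction G S] [Finite S] {σ : G}
    (hσ : orderOf σ = 2) :
    Nat.card S + (fixedBy S σ).ncard =
      Nat.card (orbitRel.Quotient (Subgroup.zpowers σ) S) * 2 := by
  classical
  have : Fintype S := Fintype.ofFinite S
  have hfin : Finite (Subgroup.zpowers σ) := by
    apply Nat.finite_of_card_ne_zero
    rw [Nat.card_zpowers, hσ]; norm_num
  have : Fintype (Subgroup.zpowers σ) := Fintype.ofFinite _
  have hc : Fintype.card (Subgroup.zpowers σ) = 2 := by
    rw [← Nat.card_eq_fintype_card, Nat.card_zpowers, hσ]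
  have : Fintype (orbitRel.Quotient (Subgroup.zpowers σ) S) := Fintype.ofFinite _
  have h := sum_card_fixedBy_eq_card_orbits_mul_card_group (Subgroup.zpowers σ) S
  let τ : Subgroup.zpowers σ := ⟨σ, Subgroup.mem_zpowers σ⟩
  have hτ : (1 : Subgroup.zpowers σ) ≠ τ := by
    intro h
    have : σ = 1 := (congrArg Subtype.val h).symm
    rw [this, orderOf_one] at hσ
    omega
  have huniv : (Finset.univ : Finset (Subgroup.zpowers σ)) = {1, τ} := by
    symm
    rw [← Finset.card_eq_iff_eq_univ, Finset.card_pair hτ, hc]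
  rw [huniv, Finset.sum_pair hτ, hc] at h
  rw [Nat.card_eq_fintype_card, Nat.card_eq_fintype_card, ← h]
  congr 1
  · rw [← Nat.card_eq_fintype_card, ← Nat.card_eq_fintype_card]
    refine Nat.card_congr (Equiv.subtypeUnivEquiv fun s => ?_).symm
    exact one_smul _ s
  · rw [← Nat.card_eq_fintype_card]
    rfl

theorem card_orbits_bot {G S : Type*} [Group G] [MulAction G S] :
    Nat.card (orbitRel.Quotient (⊥ : Subgroup G) S) = Nat.card S := by
  refine (Nat.card_congr (Equiv.ofBijective (Quotient.mk (orbitRel (⊥ : Subgroup G) S))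
    ⟨fun s t h => ?_, Quotient.mk_surjective⟩)).symm
  obtain ⟨g, hg⟩ := orbitRel_apply.mp (Quotient.exact h)
  rw [← hg, Subsingleton.elim g 1]
  exact one_smul _ t

/-- A fixed point would have `⟨σ⟩` inside its stabilizer, forcing `σ` to have order at most two. -/
theorem fixedBy_eq_empty_of_card_stabilizer_le {G S : Type*} [Group G] [Finite G] [MulAction G S]
    (hS : ∀ s : S, Nat.card (stabilizer G s) ≤ 2) {σ : G} (h1 : σ ≠ 1) (h2 : orderOf σ ≠ 2) :
    fixedBy S σ = ∅ := by
  refine Set.eq_empty_iff_forall_notMem.mpr fun s hs => ?_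
  have h3 : Nat.card (Subgroup.zpowers σ) ≤ Nat.card (stabilizer G s) :=
    Subgroup.card_le_of_le (Subgroup.zpowers_le.mpr hs)
  rw [Nat.card_zpowers] at h3
  have h4 := hS s
  have h5 := orderOf_pos σ
  have h6 : orderOf σ ≠ 1 := fun h => h1 (orderOf_eq_one_iff.mp h)
  omega

/-- A subgroup of order at most two containing `σ ≠ 1` is generated by `σ`; this applies both to `H`
and to the stabilizer of a fixed point of `σ`. -/
theorem setOf_stabilizer_eq_fixedBy {G S : Type*} [Group G] [Finite G] [MulAction G S]
    (hS : ∀ s : S, Nat.card (stabilizer G s) ≤ 2) {H : Subgroup G} (hH : Nat.card H ≤ 2)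
    {σ : G} (hσ : σ ∈ H) (h1 : σ ≠ 1) : {s : S | stabilizer G s = H} = fixedBy S σ := by
  have key : ∀ K : Subgroup G, Nat.card K ≤ 2 → σ ∈ K → Subgroup.zpowers σ = K := by
    intro K hK hs
    refine Subgroup.eq_of_le_of_card_ge (Subgroup.zpowers_le.mpr hs) ?_
    rw [Nat.card_zpowers]
    have h5 := orderOf_pos σ
    have h6 : orderOf σ ≠ 1 := fun h => h1 (orderOf_eq_one_iff.mp h)
    omega
  ext s
  constructor
  · intro (h : stabilizer G s = H)
    exact mem_stabilizer_iff.mp (h ▸ hσ)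
  · intro h
    exact (key _ (hS s) h).symm.trans (key _ hH hσ)

theorem card_eq_sum_ncard_stabilizer {G S : Type*} [Group G] [MulAction G S]
    [Finite S] [Fintype (Subgroup G)] :
    Nat.card S = ∑ H : Subgroup G, {s : S | stabilizer G s = H}.ncard := by
  rw [Nat.card_congr (Equiv.sigmaFiberEquiv (stabilizer G : S → Subgroup G)).symm, Nat.card_sigma]
  rfl

/-- Two finite `G`-sets with stabilizers of order at most two that have the same number of
`H`-orbits for every subgroup `H` are isomorphic. -/
theorem exists_equivariant_equiv_of_card_orbits {G : Type*} {S : Type v} {S' : Type w} [Group G]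
    [Finite G] [MulAction G S] [MulAction G S'] [Finite S] [Finite S']
    (hS : ∀ s : S, Nat.card (stabilizer G s) ≤ 2) (hS' : ∀ s : S', Nat.card (stabilizer G s) ≤ 2)
    (h : ∀ H : Subgroup G, Nat.card (orbitRel.Quotient H S) = Nat.card (orbitRel.Quotient H S')) :
    ∃ e : S ≃ S', ∀ (g : G) (s : S), e (g • s) = g • e s := by
  classical
  have hcard : Nat.card S = Nat.card S' := by
    rw [← card_orbits_bot (G := G), h, card_orbits_bot]
  have hfix : ∀ σ : G, σ ≠ 1 → (fixedBy S σ).ncard = (fixedBy S' σ).ncard := by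
    intro σ h1
    by_cases h2 : orderOf σ = 2
    · have h3 := card_add_ncard_fixedBy (S := S) h2
      have h4 := card_add_ncard_fixedBy (S := S') h2
      rw [h] at h3
      omega
    · rw [fixedBy_eq_empty_of_card_stabilizer_le hS h1 h2,
        fixedBy_eq_empty_of_card_stabilizer_le hS' h1 h2, Set.ncard_empty, Set.ncard_empty]
  have hne : ∀ H : Subgroup G, H ≠ ⊥ →
      {s : S | stabilizer G s = H}.ncard = {s : S' | stabilizer G s = H}.ncard := by
    intro H hH
    obtain ⟨σ, hσ, h1⟩ := H.bot_or_exists_ne_one.resolve_left hH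
    by_cases hc : Nat.card H ≤ 2
    · rw [setOf_stabilizer_eq_fixedBy hS hc hσ h1, setOf_stabilizer_eq_fixedBy hS' hc hσ h1,
        hfix σ h1]
    · have h3 : {s : S | stabilizer G s = H} = ∅ :=
        Set.eq_empty_iff_forall_notMem.mpr fun s hs => hc (by rw [← (hs : _ = H)]; exact hS s)
      have h4 : {s : S' | stabilizer G s = H} = ∅ :=
        Set.eq_empty_iff_forall_notMem.mpr fun s hs => hc (by rw [← (hs : _ = H)]; exact hS' s)
      rw [h3, h4, Set.ncard_empty, Set.ncard_empty]
  refine exists_equivariant_equiv_of_ncard_stabilizer _ rfl fun H => ?_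
  -- Points with trivial stabilizer are counted as all points minus those with non-trivial
  -- stabilizer.
  by_cases hH : H = ⊥
  · subst hH
    have : Fintype (Subgroup G) := Fintype.ofFinite _
    have h3 := card_eq_sum_ncard_stabilizer (G := G) (S := S)
    have h4 := card_eq_sum_ncard_stabilizer (G := G) (S := S')
    rw [← Finset.add_sum_erase _ _ (Finset.mem_univ ⊥)] at h3 h4
    rw [Finset.sum_congr rfl fun H hH => hne H (Finset.ne_of_mem_erase hH)] at h3
    omega
  · exact hne H hH

end GSets

/-! ### Ranks of fixed points under extension of scalars to `ℚ[G]` -/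

section FixedPoints

/-- The elements of an `R[G]`-module that are fixed by a subgroup `H` of `G`. -/
def groupFixed {R G : Type*} [Ring R] [Group G] (H : Subgroup G) (M : Type*) [AddCommGroup M]
    [Module (MonoidAlgebra R G) M] : Submodule ℤ M where
  carrier := {m | ∀ h ∈ H, MonoidAlgebra.of R G h • m = m}
  zero_mem' _ _ := smul_zero _
  add_mem' hm hn h hh := by rw [smul_add, hm h hh, hn h hh]
  smul_mem' n m hm h hh := by rw [smul_comm, hm h hh]

theorem finrank_groupFixed_congr {R G : Type*} [Ring R] [Group G] (H : Subgroup G)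
    {M N : Type*} [AddCommGroup M] [Module (MonoidAlgebra R G) M] [AddCommGroup N]
    [Module (MonoidAlgebra R G) N] (e : M ≃ₗ[MonoidAlgebra R G] N) :
    Module.finrank ℤ (groupFixed (R := R) H M) = Module.finrank ℤ (groupFixed (R := R) H N) := by
  let e' : M ≃ₗ[ℤ] N := e.toAddEquiv.toIntLinearEquiv
  have he : (groupFixed (R := R) H M).map (e' : M →ₗ[ℤ] N) = groupFixed (R := R) H N := by
    ext n
    constructor
    · rintro ⟨m, hm, rfl⟩ h hh
      exact (e.map_smul _ m).symm.trans (congrArg e (hm h hh))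
    · intro hn
      refine ⟨e.symm n, fun h hh => ?_, e.apply_symm_apply n⟩
      exact (e.symm.map_smul _ n).symm.trans (congrArg e.symm (hn h hh))
  exact (e'.submoduleMap (groupFixed (R := R) H M)).finrank_eq.trans (by rw [he])

variable {G : Type u} [Group G] {M : Type w} [AddCommGroup M] [Module (MonoidAlgebra ℤ G) M]

/-- The canonical map `M → ℚ[G] ⊗_{ℤ[G]} M`. -/
noncomputable def toExtendRat (G : Type u) [Group G] (M : Type w) [AddCommGroup M]
    [Module (MonoidAlgebra ℤ G) M] : M →ₗ[ℤ] ExtendScalars (intToRat G) M :=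
  AddMonoidHom.toIntLinearMap
    { toFun := fun m => Submodule.Quotient.mk ((1 : MonoidAlgebra ℚ G) ⊗ₜ[ℤ] m)
      map_zero' := by rw [tmul_zero, Submodule.Quotient.mk_zero]
      map_add' := fun m n => by rw [tmul_add, Submodule.Quotient.mk_add] }

theorem toExtendRat_apply (m : M) :
    toExtendRat G M m = Submodule.Quotient.mk ((1 : MonoidAlgebra ℚ G) ⊗ₜ[ℤ] m) := rfl

theorem mk_mul_tmul (s : MonoidAlgebra ℚ G) (r : MonoidAlgebra ℤ G) (m : M) :
    (Submodule.Quotient.mk ((s * intToRat G r) ⊗ₜ[ℤ] m) : ExtendScalars (intToRat G) M) =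
      Submodule.Quotient.mk (s ⊗ₜ[ℤ] (r • m)) :=
  (Submodule.Quotient.eq _).mpr (Submodule.subset_span ⟨s, r, m, rfl⟩)

theorem intToRat_of (g : G) : intToRat G (MonoidAlgebra.of ℤ G g) = MonoidAlgebra.of ℚ G g := by
  simp [intToRat]

theorem toExtendRat_smul (r : MonoidAlgebra ℤ G) (m : M) :
    toExtendRat G M (r • m) = intToRat G r • toExtendRat G M m := by
  rw [toExtendRat_apply, toExtendRat_apply, ← mk_mul_tmul, ← Submodule.Quotient.mk_smul, one_mul,
    smul_tmul', smul_eq_mul, mul_one]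

/-- The map `ℚ[G] ⊗_ℤ M → ℚ ⊗_ℤ M` that sends `q g ⊗ m` to `q ⊗ g m`. -/
noncomputable def ratTensorAux (G : Type u) [Group G] (M : Type w) [AddCommGroup M]
    [Module (MonoidAlgebra ℤ G) M] : MonoidAlgebra ℚ G ⊗[ℤ] M →ₗ[ℤ] ℚ ⊗[ℤ] M :=
  TensorProduct.lift <| AddMonoidHom.toIntLinearMap
    { toFun := fun a => AddMonoidHom.toIntLinearMap
        { toFun := fun m => a.coeff.sum fun g q => q ⊗ₜ[ℤ] (MonoidAlgebra.of ℤ G g • m)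
          map_zero' := by simp
          map_add' := fun m n => by simp [smul_add, tmul_add, Finsupp.sum_add] }
      map_zero' := by ext; simp
      map_add' := fun a b => by
        ext m
        simp only [AddMonoidHom.toIntLinearMap, AddMonoidHom.coe_mk, LinearMap.add_apply,
          MonoidAlgebra.coeff_add]
        exact Finsupp.sum_add_index'
          (h := fun g q => q ⊗ₜ[ℤ] ((MonoidAlgebra.of ℤ G g : MonoidAlgebra ℤ G) • m))
          (fun _ => zero_tmul _ _) (fun _ _ _ => add_tmul _ _ _) }

theorem ratTensorAux_single (g : G) (q : ℚ) (m : M) :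
    ratTensorAux G M (MonoidAlgebra.single g q ⊗ₜ[ℤ] m) = q ⊗ₜ[ℤ] (MonoidAlgebra.of ℤ G g • m) := by
  change (MonoidAlgebra.single g q).coeff.sum
    (fun g q => q ⊗ₜ[ℤ] (MonoidAlgebra.of ℤ G g • m)) = _
  rw [MonoidAlgebra.coeff_single, Finsupp.sum_single_index]
  exact zero_tmul _ _

theorem ratTensorAux_balanced (s : MonoidAlgebra ℚ G) (r : MonoidAlgebra ℤ G) (m : M) :
    ratTensorAux G M ((s * intToRat G r) ⊗ₜ[ℤ] m) = ratTensorAux G M (s ⊗ₜ[ℤ] (r • m)) := by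
  induction s using MonoidAlgebra.induction_linear with
  | zero => simp
  | add s t hs ht => rw [add_mul, add_tmul, add_tmul, map_add, map_add, hs, ht]
  | single g q =>
    induction r using MonoidAlgebra.induction_linear with
    | zero => simp
    | add s t hs ht => rw [map_add, mul_add, add_tmul, add_smul, tmul_add, map_add, map_add, hs, ht]
    | single h n =>
      have h1 : intToRat G (MonoidAlgebra.single h n) = MonoidAlgebra.single h (n : ℚ) := by
        simp [intToRat]
      have h2 : (MonoidAlgebra.single h n : MonoidAlgebra ℤ G) = n • MonoidAlgebra.of ℤ G h := by
        simp
      rw [h1, MonoidAlgebra.single_mul_single, ratTensorAux_single, ratTensorAux_single, h2,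
        map_mul, mul_smul, smul_assoc, smul_comm _ n, mul_comm q, ← zsmul_eq_mul, tmul_smul n]
      exact (smul_tmul' n q _).symm

/-- The map `ℚ[G] ⊗_{ℤ[G]} M → ℚ ⊗_ℤ M` that sends `q g ⊗ m` to `q ⊗ g m`. -/
noncomputable def extendRatToTensor (G : Type u) [Group G] (M : Type w) [AddCommGroup M]
    [Module (MonoidAlgebra ℤ G) M] : ExtendScalars (intToRat G) M →+ ℚ ⊗[ℤ] M :=
  QuotientAddGroup.lift (balancedRelations (intToRat G) M).toAddSubgroup
    (ratTensorAux G M).toAddMonoidHom fun t ht => by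
      -- The relations form a `ℚ[G]`-span while the map is only known to be additive, so the
      -- induction must cover all multiples `a • t`.
      have key : ∀ a : MonoidAlgebra ℚ G, ratTensorAux G M (a • t) = 0 := by
        refine Submodule.span_induction (p := fun t _ => ∀ a, ratTensorAux G M (a • t) = 0)
          ?_ ?_ ?_ ?_ ht
        · rintro _ ⟨s, r, m, rfl⟩ a
          rw [smul_sub, smul_tmul', smul_tmul', smul_eq_mul, smul_eq_mul, ← mul_assoc, map_sub,
            ratTensorAux_balanced, sub_self]
        · intro a
          rw [smul_zero, map_zero]
        · intro x y _ _ hx hy a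
          rw [smul_add, map_add, hx, hy, add_zero]
        · intro b x _ hx a
          rw [← mul_smul]
          exact hx _
      simpa using key 1

theorem extendRatToTensor_toExtendRat (m : M) :
    extendRatToTensor G M (toExtendRat G M m) = 1 ⊗ₜ[ℤ] m := by
  change ratTensorAux G M ((1 : MonoidAlgebra ℚ G) ⊗ₜ[ℤ] m) = _
  rw [MonoidAlgebra.one_def, ratTensorAux_single, map_one, one_smul]

/-- Denominators can be cleared: `q g ⊗ m` times the denominator of `q` comes from `M`, and the
property passes to sums. -/
theorem exists_smul_eq_toExtendRat (y : ExtendScalars (intToRat G) M) :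
    ∃ n : ℤ, n ≠ 0 ∧ ∃ m : M, n • y = toExtendRat G M m := by
  have hadd : ∀ y z : ExtendScalars (intToRat G) M,
      (∃ n : ℤ, n ≠ 0 ∧ ∃ m : M, n • y = toExtendRat G M m) →
      (∃ n : ℤ, n ≠ 0 ∧ ∃ m : M, n • z = toExtendRat G M m) →
      ∃ n : ℤ, n ≠ 0 ∧ ∃ m : M, n • (y + z) = toExtendRat G M m := by
    rintro y z ⟨a, ha, m, hm⟩ ⟨b, hb, n, hn⟩
    refine ⟨a * b, mul_ne_zero ha hb, b • m + a • n, ?_⟩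
    rw [map_add, map_smul, map_smul, ← hm, ← hn, smul_add, mul_comm a b, mul_smul, mul_comm b a,
      mul_smul]
  have hzero : ∃ n : ℤ, n ≠ 0 ∧
      ∃ m : M, n • (0 : ExtendScalars (intToRat G) M) = toExtendRat G M m :=
    ⟨1, one_ne_zero, 0, by rw [smul_zero, map_zero]⟩
  obtain ⟨t, rfl⟩ := Submodule.Quotient.mk_surjective _ y
  induction t with
  | zero => simpa using hzero
  | add s t hs ht => exact hadd _ _ hs ht
  | tmul a m =>
    induction a using MonoidAlgebra.induction_linear with
    | zero => simpa using hzero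
    | add s t hs ht =>
      rw [add_tmul]
      exact hadd _ _ hs ht
    | single g q =>
      refine ⟨q.den, by exact_mod_cast q.den_ne_zero, q.num • MonoidAlgebra.of ℤ G g • m, ?_⟩
      have h1 : (q.den : ℤ) • (MonoidAlgebra.single g q : MonoidAlgebra ℚ G) =
          q.num • MonoidAlgebra.of ℚ G g := by
        have : (q.den : ℚ) * q = q.num := by rw [mul_comm]; exact Rat.mul_den_eq_num q
        simp [this]
      have h2 : (MonoidAlgebra.of ℚ G g : MonoidAlgebra ℚ G) =
          1 * intToRat G (MonoidAlgebra.of ℤ G g) := by rw [intToRat_of, one_mul]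
      rw [← Submodule.Quotient.mk_smul, smul_tmul', h1, ← smul_tmul', Submodule.Quotient.mk_smul,
        h2, mk_mul_tmul, map_smul, toExtendRat_apply]

/-- The map `M → ℚ ⊗_ℤ M` factors through `toExtendRat` and, being a localization, has torsion
kernel. -/
theorem exists_smul_eq_zero_of_toExtendRat_eq_zero {m : M} (hm : toExtendRat G M m = 0) :
    ∃ n : ℤ, n ≠ 0 ∧ n • m = 0 := by
  have h1 : TensorProduct.mk ℤ ℚ M 1 m = TensorProduct.mk ℤ ℚ M 1 0 := by
    rw [TensorProduct.mk_apply, ← extendRatToTensor_toExtendRat (G := G), hm, map_zero, map_zero]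
  obtain ⟨c, hc⟩ := IsLocalizedModule.exists_of_eq (S := nonZeroDivisors ℤ) h1
  exact ⟨c, nonZeroDivisors.ne_zero c.2, by rw [smul_zero] at hc; exact hc⟩

/-- The restriction of `M → ℚ[G] ⊗_{ℤ[G]} M` to the elements fixed by `H`. -/
noncomputable def toExtendRatFixed (H : Subgroup G) (M : Type w) [AddCommGroup M]
    [Module (MonoidAlgebra ℤ G) M] : groupFixed (R := ℤ) H M →ₗ[ℤ]
      groupFixed (R := ℚ) H (ExtendScalars (intToRat G) M) :=
  (toExtendRat G M).restrict fun m hm h hh => by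
    rw [← intToRat_of, ← toExtendRat_smul, hm h hh]

theorem exists_common_smul_eq_zero {G M : Type*} [Finite G] [AddCommGroup M] (f : G → M)
    (hf : ∀ g, ∃ n : ℤ, n ≠ 0 ∧ n • f g = 0) : ∃ n : ℤ, n ≠ 0 ∧ ∀ g, n • f g = 0 := by
  have := Fintype.ofFinite G
  choose n hn h using hf
  refine ⟨∏ g, n g, Finset.prod_ne_zero_iff.mpr fun g _ => hn g, fun g => ?_⟩
  obtain ⟨k, hk⟩ := Finset.dvd_prod_of_mem n (Finset.mem_univ g)
  rw [hk, mul_comm, mul_smul, h, smul_zero]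

/-- Fixed points commute with inverting integers because `G` is finite: a preimage of a fixed
element is fixed only up to torsion, but one integer kills all the finitely many errors. -/
theorem isLocalizedModule_toExtendRatFixed [Finite G] (H : Subgroup G) :
    IsLocalizedModule (nonZeroDivisors ℤ) (toExtendRatFixed H M) where
  map_units n := by
    have hn : ((n : ℤ) : ℚ) ≠ 0 := by exact_mod_cast nonZeroDivisors.ne_zero n.2
    have hsm : ∀ y : ExtendScalars (intToRat G) M,
        (n : ℤ) • y = (algebraMap ℚ (MonoidAlgebra ℚ G) (n : ℤ)) • y := by
      intro y
      rw [← Int.cast_smul_eq_zsmul (MonoidAlgebra ℚ G), map_intCast]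
    have hinv : ∀ (q : ℚ) (y : ExtendScalars (intToRat G) M), y ∈ groupFixed (R := ℚ) H _ →
        algebraMap ℚ (MonoidAlgebra ℚ G) q • y ∈
          groupFixed (R := ℚ) H (ExtendScalars (intToRat G) M) := by
      intro q y hy h hh
      rw [← mul_smul, ← Algebra.commutes, mul_smul, hy h hh]
    rw [Module.End.isUnit_iff]
    constructor
    · intro y z hyz
      have h1 : (n : ℤ) • (y : ExtendScalars (intToRat G) M) = (n : ℤ) • (z : _) :=
        congrArg Subtype.val hyz
      rw [hsm, hsm] at h1
      have h2 := congrArg (algebraMap ℚ (MonoidAlgebra ℚ G) ((n : ℤ) : ℚ)⁻¹ • ·) h1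
      simp only [← mul_smul, ← map_mul, inv_mul_cancel₀ hn, map_one, one_smul] at h2
      exact Subtype.ext h2
    · intro y
      refine ⟨⟨_, hinv ((n : ℤ) : ℚ)⁻¹ y y.2⟩, Subtype.ext ?_⟩
      change (n : ℤ) • (algebraMap ℚ (MonoidAlgebra ℚ G) ((n : ℤ) : ℚ)⁻¹ •
        (y : ExtendScalars (intToRat G) M)) = y
      rw [hsm, ← mul_smul, ← map_mul, mul_inv_cancel₀ hn, map_one, one_smul]
  surj y := by
    obtain ⟨a, ha, m, hm⟩ := exists_smul_eq_toExtendRat (y : ExtendScalars (intToRat G) M)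
    obtain ⟨b, hb, h⟩ := exists_common_smul_eq_zero
      -- The errors `g • m - m` for `g ∈ H`, extended by zero to all of `G`.
      (fun g : G => open Classical in if g ∈ H then MonoidAlgebra.of ℤ G g • m - m else 0) (by
        intro g
        split_ifs with hg
        · refine exists_smul_eq_zero_of_toExtendRat_eq_zero (G := G) ?_
          rw [map_sub, toExtendRat_smul, intToRat_of, ← hm, smul_comm, y.2 g hg, sub_self]
        · exact ⟨1, one_ne_zero, smul_zero _⟩)
    refine ⟨⟨⟨b • m, fun g hg => ?_⟩,
      ⟨b * a, mem_nonZeroDivisors_of_ne_zero (mul_ne_zero hb ha)⟩⟩, Subtype.ext ?_⟩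
    · have h1 := h g
      rw [if_pos hg, smul_sub, sub_eq_zero] at h1
      rw [smul_comm, h1]
    · change (b * a) • (y : ExtendScalars (intToRat G) M) = toExtendRat G M (b • m)
      rw [map_smul, ← hm, mul_smul]
  exists_of_eq {x y} hxy := by
    have h1 : toExtendRat G M ((x : M) - y) = 0 := by
      rw [map_sub, sub_eq_zero]
      exact congrArg Subtype.val hxy
    obtain ⟨n, hn, h⟩ := exists_smul_eq_zero_of_toExtendRat_eq_zero h1
    refine ⟨⟨n, mem_nonZeroDivisors_of_ne_zero hn⟩, Subtype.ext ?_⟩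
    rw [smul_sub, sub_eq_zero] at h
    exact h

theorem finrank_groupFixed_extendScalars [Finite G] (H : Subgroup G) :
    Module.finrank ℤ (groupFixed (R := ℚ) H (ExtendScalars (intToRat G) M)) =
      Module.finrank ℤ (groupFixed (R := ℤ) H M) :=
  have := isLocalizedModule_toExtendRatFixed (M := M) H
  IsLocalizedModule.finrank_eq (nonZeroDivisors ℤ) (toExtendRatFixed H M) le_rfl

end FixedPoints

/-! ### Invariance of classes and extensions of scalars under isomorphism -/

section GrothendieckClasses

variable (R : Type u) [Ring R]

theorem G0.mk_of_eq_add {L M N : FGModuleCat.{max u v} R} (f : L →ₗ[R] M) (g : M →ₗ[R] N)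
    (hf : Function.Injective f) (hfg : Function.Exact f g) (hg : Function.Surjective g) :
    (QuotientAddGroup.mk (FreeAbelianGroup.of M) : G0.{u, v} R) =
      QuotientAddGroup.mk (FreeAbelianGroup.of L) + QuotientAddGroup.mk (FreeAbelianGroup.of N) := by
  refine (QuotientAddGroup.eq_iff_sub_mem (N := AddSubgroup.closure (shortExactRelations R))).mpr ?_
  exact AddSubgroup.subset_closure ⟨L, M, N, f, g, hf, hfg, hg, rfl⟩

theorem G0.mk_of_zero :
    (QuotientAddGroup.mk (FreeAbelianGroup.of (FGModuleCat.of R PUnit.{(max u v) + 1})) :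
      G0.{u, v} R) = 0 := by
  have h := G0.mk_of_eq_add.{u, v} R (L := FGModuleCat.of R PUnit) (M := FGModuleCat.of R PUnit)
    (N := FGModuleCat.of R PUnit) LinearMap.id 0 (fun _ _ h => h)
    (fun x => ⟨fun _ => ⟨x, rfl⟩, fun _ => rfl⟩) (fun x => ⟨x, rfl⟩)
  exact left_eq_add.mp h

theorem G0.cls_congr {M N : Type (max u v)} [AddCommGroup M] [Module R M] [Module.Finite R M]
    [AddCommGroup N] [Module R N] [Module.Finite R N] (e : M ≃ₗ[R] N) :
    G0.cls.{u, v} R M = G0.cls.{u, v} R N := by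
  have h := G0.mk_of_eq_add.{u, v} R (L := FGModuleCat.of R PUnit) (M := FGModuleCat.of R M)
    (N := FGModuleCat.of R N) 0 e.toLinearMap (fun _ _ _ => rfl)
    (fun x => ⟨fun h => ⟨0, (e.map_eq_zero_iff.mp h).symm⟩, by
      rintro ⟨_, rfl⟩
      exact e.map_zero⟩) e.surjective
  exact h.trans (by rw [G0.mk_of_zero, zero_add]; rfl)

end GrothendieckClasses

section ExtendScalars

variable {R : Type u} {S : Type v} [Ring R] [Ring S]

theorem map_balancedRelations_le (φ : R →+* S) {M N : Type w} [AddCommGroup M] [Module R M]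
    [AddCommGroup N] [Module R N] (e : M →ₗ[R] N) :
    balancedRelations φ M ≤ (balancedRelations φ N).comap
      (AlgebraTensorModule.lTensor S S (e.toAddMonoidHom.toIntLinearMap)) := by
  refine Submodule.span_le.mpr ?_
  rintro _ ⟨s, r, m, rfl⟩
  refine Submodule.subset_span ⟨s, r, e m, ?_⟩
  rw [map_sub, AlgebraTensorModule.lTensor_tmul, AlgebraTensorModule.lTensor_tmul, ← e.map_smul]
  rfl

theorem nonempty_extendScalars_congr (φ : R →+* S) {M N : Type w} [AddCommGroup M] [Module R M]
    [AddCommGroup N] [Module R N] (e : M ≃ₗ[R] N) :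
    Nonempty (ExtendScalars φ M ≃ₗ[S] ExtendScalars φ N) := by
  refine ⟨LinearEquiv.ofLinearMap
    (Submodule.mapQ _ _ _ (map_balancedRelations_le φ e.toLinearMap))
    (Submodule.mapQ _ _ _ (map_balancedRelations_le φ e.symm.toLinearMap)) ?_ ?_⟩
  · refine Submodule.linearMap_qext _ (AlgebraTensorModule.ext fun s n => ?_)
    exact congrArg (fun n => Submodule.Quotient.mk (s ⊗ₜ[ℤ] n)) (e.apply_symm_apply n)
  · refine Submodule.linearMap_qext _ (AlgebraTensorModule.ext fun s n => ?_)
    exact congrArg (fun n => Submodule.Quotient.mk (s ⊗ₜ[ℤ] n)) (e.symm_apply_apply n)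

end ExtendScalars

/-- An isomorphism of `G`-sets induces an isomorphism of permutation modules. -/
theorem nonempty_ofMulAction_congr {R : Type*} {G : Type u} {S S' : Type v} [CommRing R] [Group G]
    [MulAction G S] [MulAction G S'] (e : S ≃ S') (he : ∀ (g : G) (s : S), e (g • s) = g • e s) :
    Nonempty ((Representation.ofMulAction R G S).asModule ≃ₗ[MonoidAlgebra R G]
      (Representation.ofMulAction R G S').asModule) := by
  let f : MonoidAlgebra R S ≃ₗ[R] MonoidAlgebra R S' :=
    (MonoidAlgebra.coeffLinearEquiv R).trans
      ((Finsupp.domLCongr e).trans (MonoidAlgebra.coeffLinearEquiv R).symm)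
  have hf : ∀ (g : G) (m : MonoidAlgebra R S), f (Representation.ofMulAction R G S g m) =
      Representation.ofMulAction R G S' g (f m) := by
    intro g m
    induction m using MonoidAlgebra.induction_linear with
    | zero => simp
    | add s t hs ht => rw [map_add, map_add, map_add, map_add, hs, ht]
    | single s r =>
      have h1 : ∀ s, f (MonoidAlgebra.single s r) = MonoidAlgebra.single (e s) r := by
        intro s
        simp [f]
      rw [Representation.ofMulAction_single, h1, h1, Representation.ofMulAction_single, he]
  let f' : (Representation.ofMulAction R G S).asModule ≃+
    (Representation.ofMulAction R G S').asModule := f.toAddEquiv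
  refine ⟨{ f' with map_smul' := fun a m => ?_ }⟩
  change f' (a • m) = a • f' m
  induction a using MonoidAlgebra.induction_linear with
  | zero => simp
  | add s t hs ht => rw [add_smul, add_smul, map_add, hs, ht]
  | single g r =>
    rw [Representation.single_smul, Representation.single_smul]
    exact (f.map_smul r _).trans (congrArg (r • ·) (hf g m))

/-! ### Units and Archimedean places of fixed fields -/

section Fields

variable {K : Type w} [Field K] {Kbar : Type v} [Field Kbar] [Algebra K Kbar]
  {G : Type u} [Group G]

/-- The subfield of `F` fixed by a subgroup of `G`. -/
noncomputable abbrev fixedSubfield (X : GaloisPair K Kbar G) (H : Subgroup G) :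
    IntermediateField K X.field :=
  IntermediateField.fixedField (H.map X.iso.symm.toMonoidHom)

theorem mem_fixedSubfield_iff (X : GaloisPair K Kbar G) (H : Subgroup G) (y : X.field) :
    y ∈ fixedSubfield X H ↔ ∀ h ∈ H, X.iso.symm h y = y := by
  rw [IntermediateField.mem_fixedField_iff]
  constructor
  · intro hy h hh
    exact hy _ ⟨h, hh, rfl⟩
  · rintro hy _ ⟨h, hh, rfl⟩
    exact hy h hh

theorem mem_groupFixed_unitModule_iff (X : GaloisPair K Kbar G) (H : Subgroup G)
    (y : (𝓞 X.field)ˣ) :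
    X.unitsRep.asModuleEquiv.symm (Additive.ofMul y) ∈ groupFixed (R := ℤ) H X.UnitModule ↔
      ((y : 𝓞 X.field) : X.field) ∈ fixedSubfield X H := by
  rw [mem_fixedSubfield_iff]
  refine forall_congr' fun h => forall_congr' fun _ => ?_
  rw [← Representation.asModuleEquiv_symm_map_rho, EquivLike.apply_eq_iff_eq,
    ← Additive.toMul.apply_eq_iff_eq, ← Units.val_inj, RingOfIntegers.ext_iff]
  rfl

/-- The inclusion of the units of a subfield, as a map into the unit module. -/
noncomputable def subfieldUnits (X : GaloisPair K Kbar G) (L : IntermediateField K X.field) :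
    Additive (𝓞 L)ˣ →ₗ[ℤ] X.UnitModule :=
  X.unitsRep.asModuleEquiv.symm.toLinearMap ∘ₗ
    (MonoidHom.toAdditive (Units.map (algebraMap (𝓞 L) (𝓞 X.field)).toMonoidHom)).toIntLinearMap

theorem subfieldUnits_injective (X : GaloisPair K Kbar G) (L : IntermediateField K X.field) :
    Function.Injective (subfieldUnits X L) := by
  refine X.unitsRep.asModuleEquiv.symm.injective.comp ?_
  exact Units.map_injective (f := (algebraMap (𝓞 L) (𝓞 X.field)).toMonoidHom)
    (FaithfulSMul.algebraMap_injective (𝓞 L) (𝓞 X.field))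

/-- An `H`-fixed unit and its inverse both lie in the fixed field and are integral there, so the
unit comes from the ring of integers of that field. -/
theorem range_subfieldUnits (X : GaloisPair K Kbar G) (H : Subgroup G) :
    LinearMap.range (subfieldUnits X (fixedSubfield X H)) =
      groupFixed (R := ℤ) H X.UnitModule := by
  apply le_antisymm
  · rintro _ ⟨y, rfl⟩
    refine (mem_groupFixed_unitModule_iff X H _).mpr ?_
    exact (((Additive.toMul y : (𝓞 (fixedSubfield X H))ˣ) : 𝓞 (fixedSubfield X H)) :
      fixedSubfield X H).2
  · intro y hy
    obtain ⟨y, rfl⟩ := X.unitsRep.asModuleEquiv.symm.surjective y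
    obtain ⟨y, rfl⟩ := Additive.ofMul.surjective y
    have h1 := (mem_groupFixed_unitModule_iff X H y).mp hy
    have h2 : (((y⁻¹ : (𝓞 X.field)ˣ) : 𝓞 X.field) : X.field) ∈ fixedSubfield X H := by
      refine (mem_groupFixed_unitModule_iff X H y⁻¹).mp ?_
      rw [ofMul_inv, map_neg]
      exact neg_mem hy
    have lift : ∀ z : 𝓞 X.field, ∀ hz : (z : X.field) ∈ fixedSubfield X H,
        ∃ a : 𝓞 (fixedSubfield X H), algebraMap _ (𝓞 X.field) a = z := by
      intro z hz
      have : IsIntegral ℤ (⟨z, hz⟩ : fixedSubfield X H) :=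
        (isIntegral_algHom_iff ((fixedSubfield X H).val.restrictScalars ℤ)
          Subtype.val_injective).mp z.2
      exact ⟨⟨⟨z, hz⟩, this⟩, rfl⟩
    obtain ⟨a, ha⟩ := lift _ h1
    obtain ⟨b, hb⟩ := lift _ h2
    have inj := FaithfulSMul.algebraMap_injective (𝓞 (fixedSubfield X H)) (𝓞 X.field)
    refine ⟨Additive.ofMul ⟨a, b, inj ?_, inj ?_⟩, ?_⟩
    · rw [map_mul, ha, hb, map_one, Units.mul_inv]
    · rw [map_mul, ha, hb, map_one, Units.inv_mul]
    · exact congrArg (fun y => X.unitsRep.asModuleEquiv.symm (Additive.ofMul y)) (Units.ext ha)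

theorem card_stabilizer_places_le (X : GaloisPair K Kbar G) (s : X.Places) :
    Nat.card (MulAction.stabilizer G s) ≤ 2 := by
  let s' : InfinitePlace X.field := s
  have h := InfinitePlace.nat_card_stabilizer_eq_one_or_two K s'
  have : Nat.card (MulAction.stabilizer G s) =
      Nat.card (MulAction.stabilizer Gal(X.field/K) s') :=
    Nat.card_congr (X.iso.symm.toEquiv.subtypeEquiv fun _ => Iff.rfl)
  omega

variable [NumberField K] [Finite G]

theorem numberField_subfield (X : GaloisPair K Kbar G) (L : IntermediateField K X.field) :
    NumberField L := by
  have := X.numberField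
  have : FiniteDimensional K X.field := Module.Finite.of_restrictScalars_finite ℚ K X.field
  exact NumberField.of_module_finite K L

/-- Since `F` is Galois over `F^H` with group the image of `H`, places of `F` have the same
restriction to `F^H` exactly when they are `H`-conjugate. -/
theorem card_places_fixedSubfield (X : GaloisPair K Kbar G) (H : Subgroup G) :
    Nat.card (MulAction.orbitRel.Quotient H X.Places) =
      Nat.card (InfinitePlace (fixedSubfield X H)) := by
  have := X.numberField
  have := X.isGalois
  have : FiniteDimensional K X.field := Module.Finite.of_restrictScalars_finite ℚ K X.field
  let H' := H.map X.iso.symm.toMonoidHom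
  refine (Nat.card_congr (Quotient.congr (Equiv.refl (InfinitePlace X.field)) ?_)).trans
    (Nat.card_congr (InfinitePlace.orbitRelEquiv (k := fixedSubfield X H) (K := X.field)))
  intro s t
  let f := IntermediateField.subgroupEquivAlgEquiv H'
  have hf : ∀ (σ : H') (w : InfinitePlace X.field), f σ • w = (σ : Gal(X.field/K)) • w :=
    fun _ _ => rfl
  constructor
  · rintro ⟨⟨h, hh⟩, rfl⟩
    exact ⟨f ⟨X.iso.symm h, h, hh, rfl⟩, rfl⟩
  · rintro ⟨σ, hσ⟩
    obtain ⟨⟨_, h, hh, rfl⟩, rfl⟩ := f.surjective σ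
    exact ⟨⟨h, hh⟩, hσ⟩

/-- The unit theorem for all subfields fixed by subgroups of `G`. -/
theorem card_orbits_places (X : GaloisPair K Kbar G) (H : Subgroup G) :
    Nat.card (MulAction.orbitRel.Quotient H X.Places) =
      Module.finrank ℤ (groupFixed (R := ℤ) H X.UnitModule) + 1 := by
  have := numberField_subfield X (fixedSubfield X H)
  rw [card_places_fixedSubfield, ← range_subfieldUnits,
    ← (LinearEquiv.ofInjective _ (subfieldUnits_injective X _)).finrank_eq,
    NumberField.Units.finrank_eq, NumberField.Units.rank, Nat.card_eq_fintype_card]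
  -- The unit rank is a truncated difference, the number of places minus one, so positivity is
  -- needed to add the one back.
  have : 0 < Fintype.card (InfinitePlace (fixedSubfield X H)) := Fintype.card_pos
  omega

end Fields

theorem mainTheorem7
    {K : Type w} [Field K] [NumberField K]
    {Kbar : Type v} [Field Kbar] [Algebra K Kbar] [IsAlgClosure K Kbar]
    {G : Type u} [Group G] [Fintype G]
    (P : Set Nat.Primes) (hP : ∀ p ∈ P, ¬ (p : ℕ) ∣ 2 * Fintype.card G)
    (I : TwoSidedIdeal (MonoidAlgebra ℚ G)) (hI : ∑ g : G, MonoidAlgebra.of ℚ G g ∈ I)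
    (V : Type x) [AddCommGroup V] [Module (MonoidAlgebra ℚ G) V]
    [Module.Finite (MonoidAlgebra ℚ G) V]
    (X X' : GaloisPair K Kbar G) (hX : X ∈ family K Kbar P V) (hX' : X' ∈ family K Kbar P V) :
    G0.cls.{u, v} (Lam P I) (ExtendScalars (intToLam P I) X.PlaceModule) =
        G0.cls.{u, v} (Lam P I) (ExtendScalars (intToLam P I) X'.PlaceModule) ∧
      ∃ e : X.Places ≃ X'.Places, ∀ (g : G) (s : X.Places), e (g • s) = g • e s := by
  obtain ⟨e, he⟩ : ∃ e : X.Places ≃ X'.Places, ∀ (g : G) (s : X.Places), e (g • s) = g • e s := by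
    refine exists_equivariant_equiv_of_card_orbits (card_stabilizer_places_le X)
      (card_stabilizer_places_le X') fun H => ?_
    obtain ⟨_, ⟨f⟩⟩ := hX
    obtain ⟨_, ⟨f'⟩⟩ := hX'
    -- Both orbit counts become ranks of `H`-fixed points after extension to `ℚ[G]`, which are
    -- compared through `V`.
    rw [card_orbits_places, card_orbits_places, ← finrank_groupFixed_extendScalars,
      ← finrank_groupFixed_extendScalars, finrank_groupFixed_congr H (f.trans f'.symm)]
  obtain ⟨f⟩ := nonempty_ofMulAction_congr (R := ℤ) e he
  obtain ⟨f'⟩ := nonempty_extendScalars_congr (intToLam P I) f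
  exact ⟨G0.cls_congr _ f', e, he⟩
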